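/- Let $R$ be a commutative noetherian local ring that is Cohen–Macaulay (i.e. $\operatorname{depth} R=\dim R$) and generically Gorenstein (i.e. $R_{\mathfrak p}$ is a Gorenstein ring, that is, of finite injective dimension over itself, for every minimal prime $\mathfrak p$ of $R$), and let $\omega$ be a canonical module of $R$ (a finitely generated maximal Cohen–Macaulay $R$-module of type one and of finite injective dimension). Assume that $R$ satisfies the condition $(ES^R_1)$: every finitely generated $R$-module $X$ with $\operatorname{Ext}^i_R(X,R)=0$ for all $i>0$ satisfies $\operatorname{depth} X_{\mathfrak p}\ge \min\{1,\operatorname{depth} R_{\mathfrak p}\}$ for all prime ideals $\mathfrak p$ of $R$ (with $\operatorname{depth} 0=\infty$). If $\operatorname{Ext}^i_R(\omega,R)=0$ for all $i>0$, then $R$ is Gorenstein. -/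

import Mathlib

open CategoryTheory

universe u v

/-- The depth of a (finitely generated) module `M` over a local ring `R`: the supremum of the
lengths of the `M`-regular sequences in the maximal ideal. Weak regularity (the condition
`M ≠ (x₁, …, xₙ)M` is not imposed) is automatic regularity for nonzero finitely generated `M` over
a noetherian local ring, by Nakayama; for `M = 0` it gives the usual convention `depth 0 = ∞`. -/
noncomputable def moduleDepth (R : Type u) [CommRing R] [IsLocalRing R]
    (M : Type v) [AddCommGroup M] [Module R M] : ℕ∞ :=
  ⨆ (rs : List R) (_ : ∀ r ∈ rs, r ∈ IsLocalRing.maximalIdeal R)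
    (_ : RingTheory.Sequence.IsWeaklyRegular M rs), (rs.length : ℕ∞)

/-- `Ext^{>0}_R(M, N) = 0`. -/
def PosExtVanish (R : Type u) [CommRing R] (M N : Type u) [AddCommGroup M] [Module R M]
    [AddCommGroup N] [Module R N] : Prop :=
  ∀ i : ℕ, 0 < i → Subsingleton (Abelian.Ext (ModuleCat.of R M) (ModuleCat.of R N) i)

/-- The `R`-module `M` has finite injective dimension. -/
def HasFiniteInjDim (R : Type u) [CommRing R] (M : Type u) [AddCommGroup M] [Module R M] : Prop :=
  injectiveDimension (ModuleCat.of R M) ≠ ⊤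

/-- A noetherian local ring is Cohen-Macaulay if its depth equals its Krull dimension. -/
def IsCMLocalRing (R : Type u) [CommRing R] [IsLocalRing R] [IsNoetherianRing R] : Prop :=
  ((moduleDepth R R : ℕ∞) : WithBot ℕ∞) = ringKrullDim R

/-- A noetherian local ring is Gorenstein if it has finite injective dimension over itself. -/
def IsGorensteinLocalRing (R : Type u) [CommRing R] [IsLocalRing R] [IsNoetherianRing R] : Prop :=
  HasFiniteInjDim R R

/-- `R` is generically Gorenstein: `R_𝔭` is Gorenstein for each minimal prime `𝔭`. -/
def IsGenericallyGorenstein (R : Type u) [CommRing R] [IsNoetherianRing R] : Prop :=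
  ∀ (p : Ideal R) [p.IsPrime], p ∈ minimalPrimes R →
    IsGorensteinLocalRing (Localization.AtPrime p)

/-- The type of a finitely generated module `M` over a noetherian local ring with residue field
`k`: the `k`-dimension of `Ext^t(k, M)`, `t = depth M`. As the maximal ideal annihilates this
module, its `k`-dimension is its length over `R`. (Only meaningful for finite depth.) -/
noncomputable def moduleType (R : Type u) [CommRing R] [IsLocalRing R]
    (M : Type u) [AddCommGroup M] [Module R M] : ℕ∞ :=
  Module.length R (Abelian.Ext (ModuleCat.of R (IsLocalRing.ResidueField R)) (ModuleCat.of R M)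
    (moduleDepth R M).toNat)

/-- A canonical module of a Cohen-Macaulay local ring `R`: a maximal Cohen-Macaulay module of
type one and of finite injective dimension. -/
structure IsCanonicalModule (R : Type u) [CommRing R] [IsLocalRing R] [IsNoetherianRing R]
    (ω : Type u) [AddCommGroup ω] [Module R ω] : Prop where
  finite : Module.Finite R ω
  depth_eq : ((moduleDepth R ω : ℕ∞) : WithBot ℕ∞) = ringKrullDim R
  type_eq_one : moduleType R ω = 1
  finite_injDim : HasFiniteInjDim R ω

/-- The condition `(S̃_n)` on `M`: `depth M_𝔭 ≥ min {n, depth R_𝔭}` for each prime `𝔭`. -/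
def SatisfiesSTilde (R : Type u) [CommRing R] (n : ℕ) (M : Type v) [AddCommGroup M]
    [Module R M] : Prop :=
  ∀ (p : Ideal R) [p.IsPrime],
    min (n : ℕ∞) (moduleDepth (Localization.AtPrime p) (Localization.AtPrime p)) ≤
      moduleDepth (Localization.AtPrime p) (LocalizedModule p.primeCompl M)

/-- The condition `(ES_n^C)` on `R`: each finitely generated `R`-module `X` with
`Ext^{>0}_R(X, C) = 0` satisfies `(S̃_n)`. -/
def SatisfiesES (R : Type u) [CommRing R] (C : Type u) [AddCommGroup C] [Module R C]
    (n : ℕ) : Prop :=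
  ∀ (X : Type u) [AddCommGroup X] [Module R X] [Module.Finite R X],
    PosExtVanish R X C → SatisfiesSTilde R n X

/-!
Say that `X` is `R`-acyclic if it is finitely generated and `Ext^{>0}(X, R) = 0`. As `R`, being
Cohen-Macaulay, has no embedded primes, `(ES_1)` forces the associated primes of such an `X` to be
minimal primes of `R`. The localizations of `R` there are self-injective artinian rings, so
functionals detect the nonzero elements of `X`, that is, `X` is torsionless. Generators of the dual
of `X` therefore embed `X` into a finite free module `F` in such a way that every functional on `X`
extends to `F`, so that `F ⧸ X` is again `R`-acyclic. Hence `X` is an arbitrarily high syzygy, and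
dimension shifting gives `Ext^{>0}(X, ω) = 0` because `ω` has finite injective dimension. Applied
to `F ⧸ ω`, this says that `ω ↪ F` splits, so `ω` is free and `R`, a direct summand of `ω`, has
finite injective dimension.
-/

section ContravariantExt

universe w v' u'

variable {C : Type u'} [Category.{v'} C] [Abelian C] [HasExt.{w} C] {S : ShortComplex C} {Y : C}

theorem subsingleton_ext_X₁_of_shortExact (hS : S.ShortExact) {n : ℕ}
    (h₂ : Subsingleton (Abelian.Ext S.X₂ Y n)) (h₃ : Subsingleton (Abelian.Ext S.X₃ Y (n + 1))) :
    Subsingleton (Abelian.Ext S.X₁ Y n) := by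
  refine subsingleton_of_forall_eq 0 fun x ↦ ?_
  obtain ⟨y, rfl⟩ := Abelian.Ext.contravariant_sequence_exact₁ hS Y x (add_comm 1 n) (h₃.elim _ _)
  rw [h₂.elim y 0, Abelian.Ext.comp_zero]

theorem subsingleton_ext_X₂_of_shortExact (hS : S.ShortExact) {n : ℕ}
    (h₁ : Subsingleton (Abelian.Ext S.X₁ Y n)) (h₃ : Subsingleton (Abelian.Ext S.X₃ Y n)) :
    Subsingleton (Abelian.Ext S.X₂ Y n) := by
  refine subsingleton_of_forall_eq 0 fun x ↦ ?_
  obtain ⟨y, rfl⟩ := Abelian.Ext.contravariant_sequence_exact₂ hS Y x (h₁.elim _ _)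
  rw [h₃.elim y 0, Abelian.Ext.comp_zero]

theorem subsingleton_ext_X₃_of_shortExact (hS : S.ShortExact) {n : ℕ}
    (h₁ : Subsingleton (Abelian.Ext S.X₁ Y n)) (h₂ : Subsingleton (Abelian.Ext S.X₂ Y (n + 1))) :
    Subsingleton (Abelian.Ext S.X₃ Y (n + 1)) := by
  refine subsingleton_of_forall_eq 0 fun x ↦ ?_
  obtain ⟨y, rfl⟩ := Abelian.Ext.contravariant_sequence_exact₃ hS Y x (h₂.elim _ _) (add_comm 1 n)
  rw [h₁.elim y 0, Abelian.Ext.comp_zero]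

theorem exists_comp_eq_of_subsingleton_ext_one (hS : S.ShortExact)
    (h : Subsingleton (Abelian.Ext S.X₃ Y 1)) (φ : S.X₁ ⟶ Y) : ∃ ψ : S.X₂ ⟶ Y, S.f ≫ ψ = φ := by
  obtain ⟨y, hy⟩ := Abelian.Ext.contravariant_sequence_exact₁ hS Y (Abelian.Ext.mk₀ φ)
    (add_comm 1 0) (h.elim _ _)
  obtain ⟨ψ, rfl⟩ := (Abelian.Ext.mk₀_bijective _ _).2 y
  rw [Abelian.Ext.mk₀_comp_mk₀] at hy
  exact ⟨ψ, (Abelian.Ext.mk₀_bijective _ _).1 hy⟩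

theorem subsingleton_ext_one_of_forall_exists_comp_eq (hS : S.ShortExact)
    (h₂ : Subsingleton (Abelian.Ext S.X₂ Y 1))
    (hext : ∀ φ : S.X₁ ⟶ Y, ∃ ψ : S.X₂ ⟶ Y, S.f ≫ ψ = φ) :
    Subsingleton (Abelian.Ext S.X₃ Y 1) := by
  refine subsingleton_of_forall_eq 0 fun x ↦ ?_
  obtain ⟨y, rfl⟩ := Abelian.Ext.contravariant_sequence_exact₃ hS Y x (h₂.elim _ _) (add_comm 1 0)
  obtain ⟨φ, rfl⟩ := (Abelian.Ext.mk₀_bijective _ _).2 y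
  obtain ⟨ψ, rfl⟩ := hext φ
  rw [← Abelian.Ext.mk₀_comp_mk₀]
  exact hS.extClass_comp_assoc _

theorem subsingleton_ext_of_retract {X X' : C} (r : Retract X X') {n : ℕ}
    (h : Subsingleton (Abelian.Ext X' Y n)) : Subsingleton (Abelian.Ext X Y n) := by
  refine subsingleton_of_forall_eq 0 fun x ↦ ?_
  rw [← Abelian.Ext.mk₀_id_comp x, ← r.retract, ← Abelian.Ext.mk₀_comp_mk₀_assoc,
    h.elim ((Abelian.Ext.mk₀ r.r).comp x _) 0, Abelian.Ext.comp_zero]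

end ContravariantExt

section CokernelSequence

variable {R : Type u} [CommRing R] {M N : Type u} [AddCommGroup M] [Module R M]
  [AddCommGroup N] [Module R N]

/-- The sequence `M → N → N ⧸ range f` of a linear map `f : M → N`, as a short complex. -/
abbrev cokernelSequence (f : M →ₗ[R] N) : ShortComplex (ModuleCat R) :=
  ModuleCat.shortComplexOfCompEqZero f (LinearMap.range f).mkQ (LinearMap.range_mkQ_comp f)

theorem cokernelSequence_shortExact {f : M →ₗ[R] N} (hf : Function.Injective f) :
    (cokernelSequence f).ShortExact :=
  ModuleCat.shortComplex_shortExact _ (LinearMap.exact_map_mkQ_range f) hf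
    (Submodule.mkQ_surjective _)

end CokernelSequence

section FiniteInjectiveDimension

variable {R : Type u} [CommRing R] {M N : Type u} [AddCommGroup M] [Module R M]
  [AddCommGroup N] [Module R N]

theorem HasFiniteInjDim.exists_subsingleton_ext (hM : HasFiniteInjDim R M) :
    ∃ n, ∀ i, n ≤ i → ∀ X : ModuleCat R, Subsingleton (Abelian.Ext X (ModuleCat.of R M) i) := by
  obtain ⟨n, hn⟩ := (injectiveDimension_ne_top_iff _).1 hM
  exact ⟨n + 1, fun i hi X ↦ HasInjectiveDimensionLT.subsingleton _ (n + 1) i hi X⟩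

theorem HasFiniteInjDim.of_leftInverse {i : M →ₗ[R] N} {r : N →ₗ[R] M}
    (h : r ∘ₗ i = LinearMap.id) (hN : HasFiniteInjDim R N) : HasFiniteInjDim R M := by
  have e : Retract (ModuleCat.of R M) (ModuleCat.of R N) :=
    { i := ModuleCat.ofHom i
      r := ModuleCat.ofHom r
      retract := ModuleCat.hom_ext h }
  exact ne_top_of_le_ne_top hN e.injectiveDimension_le

theorem HasFiniteInjDim.self_of_free [Module.Free R M] [Nontrivial M]
    (hM : HasFiniteInjDim R M) : HasFiniteInjDim R R := by
  let b := Module.Free.chooseBasis R M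
  obtain ⟨i⟩ := b.index_nonempty
  exact hM.of_leftInverse (i := LinearMap.toSpanSingleton R M (b i)) (r := b.coord i)
    (LinearMap.ext_ring (by simp))

end FiniteInjectiveDimension

section InjectiveOverArtinian

theorem mem_associatedPrimes_of_isArtinianRing {A : Type u} [CommRing A] [IsArtinianRing A]
    (p : Ideal A) [p.IsPrime] : p ∈ associatedPrimes A A :=
  Module.associatedPrimes.minimalPrimes_annihilator_subset_associatedPrimes A A <| by
    rw [Module.annihilator_eq_bot.2 inferInstance]
    exact Ideal.mem_minimalPrimes_of_krullDimLE_zero p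

variable {A : Type u} [CommRing A] {Q : Type u} [AddCommGroup Q] [Module A Q]

theorem subsingleton_ext_succ_of_quotient_prime [IsNoetherianRing A] {n : ℕ}
    (h : ∀ (p : Ideal A) [p.IsPrime],
      Subsingleton (Abelian.Ext (ModuleCat.of A (A ⧸ p)) (ModuleCat.of A Q) (n + 1)))
    (M : Type u) [AddCommGroup M] [Module A M] [hM : Module.Finite A M] :
    Subsingleton (Abelian.Ext (ModuleCat.of A M) (ModuleCat.of A Q) (n + 1)) := by
  induction hM using IsNoetherianRing.induction_on_isQuotientEquivQuotientPrime A with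
  | subsingleton N => exact Abelian.Ext.subsingleton_of_projective _ _ _
  | quotient N p e => exact subsingleton_ext_of_retract (.ofIso e.toModuleIso) (h p.1)
  | exact N₁ N₂ N₃ f g hf hg hfg h₁ h₃ =>
    exact subsingleton_ext_X₂_of_shortExact (ModuleCat.shortComplex_shortExact
      (ModuleCat.shortComplexOfCompEqZero f g hfg.linearMap_comp_eq_zero) hfg hf hg) h₁ h₃

theorem subsingleton_ext_succ_of_isArtinianRing [IsArtinianRing A] {n : ℕ}
    (h : ∀ (M : Type u) [AddCommGroup M] [Module A M] [Module.Finite A M],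
      Subsingleton (Abelian.Ext (ModuleCat.of A M) (ModuleCat.of A Q) (n + 2)))
    (M : Type u) [AddCommGroup M] [Module A M] [Module.Finite A M] :
    Subsingleton (Abelian.Ext (ModuleCat.of A M) (ModuleCat.of A Q) (n + 1)) := by
  refine subsingleton_ext_succ_of_quotient_prime (fun p _ ↦ ?_) M
  obtain ⟨-, f, hf⟩ := (isAssociatedPrime_iff_exists_injective_linearMap p A).1
    (mem_associatedPrimes_of_isArtinianRing p)
  exact subsingleton_ext_X₁_of_shortExact (cokernelSequence_shortExact hf)
    (Abelian.Ext.subsingleton_of_projective _ _ _) (h _)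

theorem HasFiniteInjDim.subsingleton_ext_one_of_isArtinianRing [IsArtinianRing A]
    (hQ : HasFiniteInjDim A Q) (M : Type u) [AddCommGroup M] [Module A M] [Module.Finite A M] :
    Subsingleton (Abelian.Ext (ModuleCat.of A M) (ModuleCat.of A Q) 1) := by
  obtain ⟨n, hn⟩ := hQ.exists_subsingleton_ext
  replace hn (M : Type u) [AddCommGroup M] [Module A M] [Module.Finite A M] :
    Subsingleton (Abelian.Ext (ModuleCat.of A M) (ModuleCat.of A Q) (n + 1)) := hn _ n.le_succ _
  induction n with
  | zero => exact hn M
  | succ n ih => exact ih fun M _ _ _ ↦ subsingleton_ext_succ_of_isArtinianRing hn M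

theorem HasFiniteInjDim.injective_of_isArtinianRing [IsArtinianRing A]
    (hQ : HasFiniteInjDim A Q) : Module.Injective A Q := by
  refine Module.Baer.injective fun I g ↦ ?_
  obtain ⟨ψ, hψ⟩ := exists_comp_eq_of_subsingleton_ext_one
    (cokernelSequence_shortExact I.injective_subtype)
    (hQ.subsingleton_ext_one_of_isArtinianRing _) (ModuleCat.ofHom g)
  exact ⟨ψ.hom, fun x hx ↦ LinearMap.congr_fun (congrArg ModuleCat.Hom.hom hψ) ⟨x, hx⟩⟩

end InjectiveOverArtinian

section Torsionless

theorem exists_linearMap_apply_ne_zero_of_injective {A : Type u} [CommRing A] [IsLocalRing A]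
    [IsNoetherianRing A] {Q : Type u} [AddCommGroup Q] [Module A Q] [Module.Injective A Q]
    (hQ : IsLocalRing.maximalIdeal A ∈ associatedPrimes A Q)
    {X : Type*} [AddCommGroup X] [Module A X] {x : X} (hx : x ≠ 0) :
    ∃ φ : X →ₗ[A] Q, φ x ≠ 0 := by
  obtain ⟨-, f, hf⟩ := (isAssociatedPrime_iff_exists_injective_linearMap _ Q).1 hQ
  let t := LinearMap.toSpanSingleton A X x
  have hle : LinearMap.ker t ≤ IsLocalRing.maximalIdeal A :=
    IsLocalRing.le_maximalIdeal fun h ↦ hx (by simpa [t] using (Ideal.eq_top_iff_one _).1 h)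
  obtain ⟨φ, hφ⟩ := Module.Injective.extension_property A Q _ _ ((LinearMap.ker t).liftQ t le_rfl)
    (LinearMap.ker_eq_bot.1 (Submodule.ker_liftQ_eq_bot' _ t rfl)) (f ∘ₗ Submodule.factor hle)
  have hφx : φ (t 1) = f 1 := LinearMap.congr_fun hφ (Submodule.Quotient.mk 1)
  refine ⟨φ, ?_⟩
  rw [← one_smul A x, ← LinearMap.toSpanSingleton_apply, hφx]
  exact (map_ne_zero_iff f hf).2 one_ne_zero

theorem exists_linearMap_apply_ne_zero_of_isLocalizedModule {R : Type*} [CommRing R]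
    (S : Submonoid R) {X N N' : Type*} [AddCommGroup X] [Module R X]
    [Module.FinitePresentation R X] [AddCommGroup N] [Module R N] [AddCommGroup N'] [Module R N']
    (g : N →ₗ[R] N') [IsLocalizedModule S g] {ψ : X →ₗ[R] N'} {x : X} (hx : ψ x ≠ 0) :
    ∃ φ : X →ₗ[R] N, φ x ≠ 0 := by
  obtain ⟨φ, s, hφ⟩ := Module.FinitePresentation.exists_lift_of_isLocalizedModule S g ψ
  have hsx : s • ψ x ≠ 0 := fun h ↦
    hx (IsLocalizedModule.smul_injective g s (h.trans (smul_zero s).symm))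
  refine ⟨φ, fun h ↦ hsx ?_⟩
  rw [← LinearMap.smul_apply, ← hφ, LinearMap.comp_apply, h, map_zero]

/-- A module is torsionless if its canonical map to the bidual is injective, that is, if each of
its nonzero elements is detected by a linear functional. -/
def IsTorsionless (R : Type*) [CommRing R] (M : Type*) [AddCommGroup M] [Module R M] : Prop :=
  Function.Injective (Module.Dual.eval R M)

theorem isTorsionless_iff {R : Type*} [CommRing R] {M : Type*} [AddCommGroup M] [Module R M] :
    IsTorsionless R M ↔ ∀ x : M, x ≠ 0 → ∃ φ : M →ₗ[R] R, φ x ≠ 0 := by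
  rw [IsTorsionless, injective_iff_map_eq_zero]
  exact forall_congr' fun x ↦ not_imp_not.symm.trans (by simp [LinearMap.ext_iff])

variable {R : Type u} [CommRing R] [IsNoetherianRing R]

theorem IsGenericallyGorenstein.isTorsionless (hgen : IsGenericallyGorenstein R)
    {X : Type*} [AddCommGroup X] [Module R X] [Module.Finite R X]
    (hX : associatedPrimes R X ⊆ minimalPrimes R) : IsTorsionless R X := by
  refine isTorsionless_iff.2 fun x hx ↦ ?_
  obtain ⟨p, hpX, hxp⟩ := exists_le_isAssociatedPrime_of_isNoetherianRing R x hx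
  have hp := hX hpX
  have := hpX.isPrime
  let A := Localization.AtPrime p
  have : Ring.KrullDimLE 0 A := .of_isLocalization p hp A
  have : IsArtinianRing A := IsNoetherianRing.isArtinianRing_of_krullDimLE_zero
  have : Module.Injective A A := HasFiniteInjDim.injective_of_isArtinianRing (hgen p hp)
  have hx' : LocalizedModule.mkLinearMap p.primeCompl X x ≠ 0 := fun h ↦ by
    obtain ⟨s, hs⟩ := (IsLocalizedModule.eq_zero_iff p.primeCompl _).1 h
    exact s.2 (hxp (by simpa [Submodule.mem_colon_singleton, Submonoid.smul_def] using hs))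
  obtain ⟨ψ, hψ⟩ := exists_linearMap_apply_ne_zero_of_injective
    (mem_associatedPrimes_of_isArtinianRing (IsLocalRing.maximalIdeal A)) hx'
  have := Module.finitePresentation_of_finite R X
  exact exists_linearMap_apply_ne_zero_of_isLocalizedModule p.primeCompl (Algebra.linearMap R A)
    (ψ := ψ.restrictScalars R ∘ₗ LocalizedModule.mkLinearMap p.primeCompl X) hψ

end Torsionless

section Depth

variable {R : Type*} [CommRing R] [IsLocalRing R] {M : Type*} [AddCommGroup M] [Module R M]

theorem moduleDepth_eq_zero_iff_forall_not_isSMulRegular :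
    moduleDepth R M = 0 ↔ ∀ r ∈ IsLocalRing.maximalIdeal R, ¬ IsSMulRegular M r := by
  simp only [moduleDepth, ENat.iSup_eq_zero, Nat.cast_eq_zero, List.length_eq_zero_iff]
  refine ⟨fun h r hr hreg ↦ ?_, fun h rs hrs hreg ↦ ?_⟩
  · exact List.cons_ne_nil r [] (h [r] (by simpa using hr) (by simpa using hreg))
  · cases rs with
    | nil => rfl
    | cons r rs =>
      exact absurd ((RingTheory.Sequence.isWeaklyRegular_cons_iff _ _ _).1 hreg).1
        (h r (hrs r List.mem_cons_self))

theorem moduleDepth_eq_top_of_subsingleton [Subsingleton M] : moduleDepth R M = ⊤ := by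
  refine ENat.eq_top_iff_forall_ge.2 fun n ↦ ?_
  have hmem : ∀ r ∈ List.replicate n (0 : R), r ∈ IsLocalRing.maximalIdeal R := fun r hr ↦ by
    simp [List.eq_of_mem_replicate hr]
  have hreg : RingTheory.Sequence.IsWeaklyRegular M (List.replicate n (0 : R)) :=
    ⟨fun _ _ ↦ Function.injective_of_subsingleton _⟩
  exact le_iSup_of_le _ (le_iSup₂_of_le hmem hreg (by simp))

theorem moduleDepth_eq_zero_iff_maximalIdeal_mem_associatedPrimes [IsNoetherianRing R]
    [Module.Finite R M] :
    moduleDepth R M = 0 ↔ IsLocalRing.maximalIdeal R ∈ associatedPrimes R M := by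
  have hregular : moduleDepth R M = 0 ↔
      (IsLocalRing.maximalIdeal R : Set R) ⊆ ⋃ p ∈ associatedPrimes R M, p := by
    rw [moduleDepth_eq_zero_iff_forall_not_isSMulRegular, biUnion_associatedPrimes_eq_compl_regular]
    rfl
  rw [hregular]
  refine ⟨fun h ↦ ?_, fun h ↦ Set.subset_biUnion_of_mem h⟩
  obtain ⟨p, hp, hle⟩ := (Ideal.subset_union_prime_finite (associatedPrimes.finite R M)
    (f := id) 0 0 fun p hp _ _ ↦ hp.isPrime).1 h
  rwa [← (IsLocalRing.le_maximalIdeal hp.isPrime.ne_top).antisymm hle]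

end Depth

theorem IsCanonicalModule.nontrivial {R : Type u} [CommRing R] [IsLocalRing R]
    [IsNoetherianRing R] {ω : Type u} [AddCommGroup ω] [Module R ω]
    (hω : IsCanonicalModule R ω) : Nontrivial ω := by
  by_contra h
  rw [not_nontrivial_iff_subsingleton] at h
  have hdim := hω.depth_eq
  rw [moduleDepth_eq_top_of_subsingleton] at hdim
  exact ringKrullDim_ne_top hdim.symm

section STilde

variable {R : Type*} [CommRing R] [IsNoetherianRing R] {M : Type*} [AddCommGroup M] [Module R M]

theorem moduleDepth_atPrime_eq_zero_iff [Module.Finite R M] (p : Ideal R) [p.IsPrime]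
    {M' : Type*} [AddCommGroup M'] [Module R M'] [Module (Localization.AtPrime p) M']
    [IsScalarTower R (Localization.AtPrime p) M'] (f : M →ₗ[R] M')
    [IsLocalizedModule p.primeCompl f] :
    moduleDepth (Localization.AtPrime p) M' = 0 ↔ p ∈ associatedPrimes R M := by
  have : Module.Finite (Localization.AtPrime p) M' := .of_isLocalizedModule p.primeCompl f
  have hcomap :=
    Module.associatedPrimes.preimage_comap_associatedPrimes_eq_associatedPrimes_of_isLocalizedModule
      p.primeCompl (Localization.AtPrime p) f
  rw [moduleDepth_eq_zero_iff_maximalIdeal_mem_associatedPrimes, ← hcomap, Set.mem_preimage,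
    ← Ideal.under_def, Localization.AtPrime.under_maximalIdeal]

theorem SatisfiesSTilde.associatedPrimes_subset [Module.Finite R M] {n : ℕ} (hn : n ≠ 0)
    (hM : SatisfiesSTilde R n M) : associatedPrimes R M ⊆ associatedPrimes R R := by
  intro p hp
  have := hp.isPrime
  have h := hM p
  rw [(moduleDepth_atPrime_eq_zero_iff p (LocalizedModule.mkLinearMap p.primeCompl M)).2 hp,
    nonpos_iff_eq_zero, min_eq_zero, Nat.cast_eq_zero] at h
  exact (moduleDepth_atPrime_eq_zero_iff p (Algebra.linearMap R _)).1 (h.resolve_left hn)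

end STilde

section Unmixedness

open scoped Pointwise

variable {R : Type*} [CommRing R] {M : Type*} [AddCommGroup M] [Module R M]

theorem torsionBySet_eq_bot_of_le_smul_top {I : Ideal R} {r : R} (hr : r ∈ Ideal.jacobson ⊥)
    (hreg : IsSMulRegular M r) (hfg : (Submodule.torsionBySet R M I).FG)
    (hle : Submodule.torsionBySet R M I ≤ r • ⊤) : Submodule.torsionBySet R M I = ⊥ := by
  refine Submodule.eq_bot_of_le_smul_of_le_jacobson_bot (Ideal.span {r}) _ hfg (fun m hm ↦ ?_)
    ((Ideal.span_singleton_le_iff_mem _).2 hr)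
  obtain ⟨m', -, rfl⟩ := (Submodule.mem_smul_pointwise_iff_exists _ _ _).1 (hle hm)
  refine Submodule.smul_mem_smul (Ideal.mem_span_singleton_self r) ?_
  rw [Submodule.mem_torsionBySet_iff] at hm ⊢
  exact fun a ↦ hreg (by simpa only [smul_comm r, smul_zero] using hm a)

theorem exists_lt_isAssociatedPrime_quotSMulTop [IsNoetherianRing R] [Module.Finite R M]
    {p : Ideal R} (hp : IsAssociatedPrime p M) {r : R} (hr : r ∈ Ideal.jacobson ⊥)
    (hreg : IsSMulRegular M r) : ∃ q, IsAssociatedPrime q (QuotSMulTop r M) ∧ p < q := by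
  obtain ⟨hp', y, hy⟩ := isAssociatedPrime_iff.1 hp
  have hy0 : y ≠ 0 := by
    rintro rfl
    exact hp'.ne_top (by simp [hy])
  have hpy (a : R) (ha : a ∈ p) : a • y = 0 := by
    rw [hy, Submodule.mem_colon_singleton] at ha
    simpa using ha
  have hnot : ¬ Submodule.torsionBySet R M p ≤ r • ⊤ := fun hle ↦ by
    have hbot := torsionBySet_eq_bot_of_le_smul_top hr hreg (IsNoetherian.noetherian _) hle
    refine hy0 ((Submodule.mem_bot R).1 (hbot ▸ ?_))
    exact (Submodule.mem_torsionBySet_iff _ _).2 fun a ↦ hpy a a.2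
  -- The class of `m` in `M ⧸ r • M` is nonzero and killed by both `p` and `r`.
  obtain ⟨m, hm, hmr⟩ := SetLike.not_le_iff_exists.1 hnot
  rw [Submodule.mem_torsionBySet_iff] at hm
  obtain ⟨q, hq, hle⟩ := exists_le_isAssociatedPrime_of_isNoetherianRing R
    (Submodule.Quotient.mk m : QuotSMulTop r M) (mt (Submodule.Quotient.mk_eq_zero _).1 hmr)
  have hmem (a : R) (ha : a • m ∈ r • (⊤ : Submodule R M)) : a ∈ q := hle <| by
    rwa [Submodule.mem_colon_singleton, Submodule.mem_bot, ← Submodule.Quotient.mk_smul,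
      Submodule.Quotient.mk_eq_zero]
  have hrq : r ∈ q := hmem r (Submodule.smul_mem_pointwise_smul _ _ _ trivial)
  have hrp : r ∉ p := fun h ↦ hy0 (hreg (by simpa using hpy r h))
  exact ⟨q, hq, fun a ha ↦ hmem a (by simp [hm ⟨a, ha⟩]), fun h ↦ hrp (h hrq)⟩

variable [IsNoetherianRing R] [Module.Finite R M]

theorem length_le_coheight_of_isWeaklyRegular {rs : List R}
    (hrs : ∀ r ∈ rs, r ∈ Ideal.jacobson ⊥) (hreg : RingTheory.Sequence.IsWeaklyRegular M rs)
    {p : PrimeSpectrum R} (hp : IsAssociatedPrime p.asIdeal M) :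
    (rs.length : ℕ∞) ≤ Order.coheight p := by
  induction rs generalizing M p with
  | nil => simp
  | cons r rs ih =>
    rw [RingTheory.Sequence.isWeaklyRegular_cons_iff] at hreg
    obtain ⟨q, hq, hpq⟩ :=
      exists_lt_isAssociatedPrime_quotSMulTop hp (hrs r List.mem_cons_self) hreg.1
    let q' : PrimeSpectrum R := ⟨q, hq.isPrime⟩
    have hlt : p < q' := hpq
    calc ((r :: rs).length : ℕ∞) = rs.length + 1 := by simp
      _ ≤ Order.coheight q' + 1 := by
        gcongr
        exact ih (fun s hs ↦ hrs s (List.mem_cons_of_mem r hs)) hreg.2 hq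
      _ ≤ Order.coheight p := Order.coheight_add_one_le hlt

theorem moduleDepth_le_coheight [IsLocalRing R] {p : PrimeSpectrum R}
    (hp : IsAssociatedPrime p.asIdeal M) : moduleDepth R M ≤ Order.coheight p :=
  iSup_le fun _ ↦ iSup₂_le fun hrs hreg ↦ length_le_coheight_of_isWeaklyRegular
    (fun r hr ↦ IsLocalRing.maximalIdeal_le_jacobson _ (hrs r hr)) hreg hp

end Unmixedness

theorem IsCMLocalRing.associatedPrimes_subset_minimalPrimes {R : Type u} [CommRing R]
    [IsLocalRing R] [IsNoetherianRing R] (hCM : IsCMLocalRing R) :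
    associatedPrimes R R ⊆ minimalPrimes R := by
  intro p hp
  have := hp.isPrime
  obtain ⟨q, hq, hqp⟩ := Ideal.exists_minimalPrimes_le (bot_le : ⊥ ≤ p)
  obtain rfl | hlt := hqp.eq_or_lt
  · exact hq
  let p' : PrimeSpectrum R := ⟨p, hp.isPrime⟩
  let q' : PrimeSpectrum R := ⟨q, hq.isPrime⟩
  have hdepth : moduleDepth R R < Order.coheight q' :=
    (moduleDepth_le_coheight (p := p') hp).trans_lt
      (Order.coheight_strictAnti (show q' < p' from hlt) (Order.coheight_lt_top p'))
  have hdim : Order.coheight q' ≤ moduleDepth R R :=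
    WithBot.coe_le_coe.1 ((Order.coheight_le_krullDim q').trans_eq hCM.symm)
  exact absurd hdim hdepth.not_ge

section LeftApproximation

variable {R : Type u} [CommRing R]

theorem exists_linearMap_pi_forall_exists_comp_eq {X : Type*} [AddCommGroup X] [Module R X]
    [Module.Finite R (Module.Dual R X)] :
    ∃ (n : ℕ) (f : X →ₗ[R] Fin n → R), ∀ φ : X →ₗ[R] R, ∃ ψ : (Fin n → R) →ₗ[R] R, ψ ∘ₗ f = φ := by
  obtain ⟨n, s, hs⟩ := Module.Finite.exists_fin (R := R) (M := Module.Dual R X)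
  refine ⟨n, LinearMap.pi s, fun φ ↦ ?_⟩
  obtain ⟨c, rfl⟩ := (Submodule.mem_span_range_iff_exists_fun R).1
    (hs ▸ Submodule.mem_top : φ ∈ Submodule.span R (Set.range s))
  exact ⟨∑ i, c i • LinearMap.proj i, by ext x; simp⟩

theorem IsTorsionless.injective {X N : Type*} [AddCommGroup X] [Module R X] [AddCommGroup N]
    [Module R N] (hX : IsTorsionless R X) {f : X →ₗ[R] N}
    (hf : ∀ φ : X →ₗ[R] R, ∃ ψ : N →ₗ[R] R, ψ ∘ₗ f = φ) : Function.Injective f := by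
  refine (injective_iff_map_eq_zero f).2 fun x hx ↦ by_contra fun hx0 ↦ ?_
  obtain ⟨φ, hφ⟩ := isTorsionless_iff.1 hX x hx0
  obtain ⟨ψ, rfl⟩ := hf φ
  exact hφ (by simp [hx])

theorem PosExtVanish.quotient_range {X P W : Type u} [AddCommGroup X] [Module R X]
    [AddCommGroup P] [Module R P] [Module.Projective R P] [AddCommGroup W] [Module R W]
    (hX : PosExtVanish R X W) {f : X →ₗ[R] P} (hinj : Function.Injective f)
    (hf : ∀ φ : X →ₗ[R] W, ∃ ψ : P →ₗ[R] W, ψ ∘ₗ f = φ) :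
    PosExtVanish R (P ⧸ LinearMap.range f) W := by
  have hS := cokernelSequence_shortExact hinj
  intro i hi
  match i with
  | 1 =>
    refine subsingleton_ext_one_of_forall_exists_comp_eq hS
      (Abelian.Ext.subsingleton_of_projective _ _ 0) fun φ ↦ ?_
    obtain ⟨ψ, hψ⟩ := hf φ.hom
    exact ⟨ModuleCat.ofHom ψ, ModuleCat.hom_ext hψ⟩
  | j + 2 =>
    exact subsingleton_ext_X₃_of_shortExact hS (hX (j + 1) j.succ_pos)
      (Abelian.Ext.subsingleton_of_projective _ _ (j + 1))

variable [IsNoetherianRing R]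

theorem PosExtVanish.exists_injective_pi {X : Type u} [AddCommGroup X] [Module R X]
    [Module.Finite R X] (hX : PosExtVanish R X R) (htl : IsTorsionless R X) :
    ∃ (n : ℕ) (f : X →ₗ[R] Fin n → R), Function.Injective f ∧
      PosExtVanish R ((Fin n → R) ⧸ LinearMap.range f) R := by
  obtain ⟨n, f, hf⟩ := exists_linearMap_pi_forall_exists_comp_eq (R := R) (X := X)
  have hinj := htl.injective hf
  exact ⟨n, f, hinj, hX.quotient_range hinj hf⟩

theorem PosExtVanish.of_forall_isTorsionless
    (htl : ∀ (X : Type u) [AddCommGroup X] [Module R X] [Module.Finite R X],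
      PosExtVanish R X R → IsTorsionless R X)
    {W : Type u} [AddCommGroup W] [Module R W] (hW : HasFiniteInjDim R W)
    {X : Type u} [AddCommGroup X] [Module R X] [Module.Finite R X] (hX : PosExtVanish R X R) :
    PosExtVanish R X W := by
  obtain ⟨n, hn⟩ := hW.exists_subsingleton_ext
  suffices hshift : ∀ (k : ℕ) (X : Type u) [AddCommGroup X] [Module R X] [Module.Finite R X],
      PosExtVanish R X R → ∀ i : ℕ, n ≤ i + 1 + k →
        Subsingleton (Abelian.Ext (ModuleCat.of R X) (ModuleCat.of R W) (i + 1)) by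
    rintro (_ | i) hi
    · exact absurd hi (lt_irrefl 0)
    · exact hshift n X hX i (by lia)
  intro k
  induction k with
  | zero => exact fun X _ _ _ _ i hi ↦ hn _ hi _
  | succ k ih =>
    intro X _ _ _ hX i hi
    obtain ⟨m, f, hf, hcoker⟩ := hX.exists_injective_pi (htl X hX)
    exact subsingleton_ext_X₁_of_shortExact (cokernelSequence_shortExact hf)
      (Abelian.Ext.subsingleton_of_projective _ _ i) (ih _ hcoker (i + 1) (by lia))

theorem HasFiniteInjDim.projective_of_forall_isTorsionless
    (htl : ∀ (X : Type u) [AddCommGroup X] [Module R X] [Module.Finite R X],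
      PosExtVanish R X R → IsTorsionless R X)
    {W : Type u} [AddCommGroup W] [Module R W] [Module.Finite R W] (hW : HasFiniteInjDim R W)
    (hExt : PosExtVanish R W R) : Module.Projective R W := by
  obtain ⟨n, f, hf, hcoker⟩ := hExt.exists_injective_pi (htl W hExt)
  have hcokerW : PosExtVanish R ((Fin n → R) ⧸ LinearMap.range f) W :=
    .of_forall_isTorsionless htl hW hcoker
  obtain ⟨r, hr⟩ := exists_comp_eq_of_subsingleton_ext_one (cokernelSequence_shortExact hf)
    (hcokerW 1 one_pos) (𝟙 (ModuleCat.of R W))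
  exact .of_split f r.hom (congrArg ModuleCat.Hom.hom hr)

end LeftApproximation

theorem corollary4p5_general (R : Type u) [CommRing R] [IsLocalRing R] [IsNoetherianRing R]
    (hAss : associatedPrimes R R ⊆ minimalPrimes R) (hgen : IsGenericallyGorenstein R)
    (ω : Type u) [AddCommGroup ω] [Module R ω] [Module.Finite R ω] [Nontrivial ω]
    (hω : HasFiniteInjDim R ω) (hES : SatisfiesES R R 1) (hExt : PosExtVanish R ω R) :
    IsGorensteinLocalRing R := by
  have htl (X : Type u) [AddCommGroup X] [Module R X] [Module.Finite R X]
      (hX : PosExtVanish R X R) : IsTorsionless R X :=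
    hgen.isTorsionless (((hES X hX).associatedPrimes_subset one_ne_zero).trans hAss)
  have : Module.Projective R ω := hω.projective_of_forall_isTorsionless htl hExt
  have : Module.Free R ω := Module.free_of_flat_of_isLocalRing
  exact hω.self_of_free

theorem corollary4p5 (R : Type u) [CommRing R] [IsLocalRing R] [IsNoetherianRing R]
    (hCM : IsCMLocalRing R) (hgen : IsGenericallyGorenstein R)
    (ω : Type u) [AddCommGroup ω] [Module R ω] (hω : IsCanonicalModule R ω)
    (hES : SatisfiesES R R 1) (hExt : PosExtVanish R ω R) :
    IsGorensteinLocalRing R :=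
  have := hω.finite
  have := hω.nontrivial
  corollary4p5_general R hCM.associatedPrimes_subset_minimalPrimes hgen ω hω.finite_injDim hES hExt
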